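/- For a sequence $(x_n)_{n\ge1}$ in $[0,1)$ and $N\ge1$ let $$D_N=\sup_{0\le u<v\le1}\left|\frac{\#\{1\le n\le N:\ x_n\in[u,v)\}}{N}-(v-u)\right|$$ denote its discrepancy, and let $\{x\}$ denote the fractional part of $x$. Let $(a_n)_{n\ge1}$ be a sequence of integers such that for some $t\in\mathbb N$ we have $|a_n|\le n^t$ for all sufficiently large $n$. Assume that there exist a number $\tau\in(0,1)$ and a strictly increasing sequence $(B_L)_{L\ge1}$ of positive integers with $(B')^L\le B_L\le B^L$ for all $L\ge1$, for some reals $B',B$ with $1<B'<B$, such that for every $\varepsilon>0$ there is an $L(\varepsilon)$ such that for all $L>L(\varepsilon)$ $$\int_0^1\left|\sum_{n=1}^{B_L}e^{2\pi i a_n\alpha}\right|d\alpha>B_L^{\tau-\varepsilon}.$$ Then for (Lebesgue-)almost all $\alpha\in[0,1)$ the following holds: for every $\varepsilon>0$, the discrepancy $D_N$ of the sequence $(\{a_n\alpha\})_{n\ge1}$ satisfies $$N D_N>N^{\tau-\varepsilon}$$ for infinitely many $N$. -/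

import Mathlib

open Classical in
/-- `countInInterval x N a b` is the number of indices `1 ≤ n ≤ N` such that `x n ∈ [a, b)`. -/
noncomputable def countInInterval (x : ℕ → ℝ) (N : ℕ) (a b : ℝ) : ℕ :=
  ((Finset.Icc 1 N).filter (fun n => x n ∈ Set.Ico a b)).card

/-- The discrepancy `D_N` of the first `N` terms `x 1, …, x N` of a sequence in `[0, 1)`:
the supremum over all `0 ≤ a < b ≤ 1` of `|A_N([a, b)) / N - (b - a)|`.
(The set is nonempty and, for `x` and `N` arbitrary, bounded above by `1`.) -/
noncomputable def discrepancy (x : ℕ → ℝ) (N : ℕ) : ℝ :=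
  sSup {r : ℝ | ∃ a b : ℝ, 0 ≤ a ∧ a < b ∧ b ≤ 1 ∧
    r = |(countInInterval x N a b : ℝ) / (N : ℝ) - (b - a)|}

/-!
Write `S_N(α) = ∑_{n ≤ N} e^{2πi a_n α}`. Koksma's inequality for the functions `e^{2πihu}` gives
`N D_N(α) ≥ |S_N(hα)| / (2πh)` for every `h ≥ 1` (`norm_expSum_nat_mul_le`), so it suffices to find,
for almost every `α`, a small `h` for which `|S_N(hα)|` is large.

The hypothesis bounds the mean of `|S_N|` from below, where `N = B_L`, but `|S_N|` may be
concentrated on a small set. By a dyadic decomposition (`exists_level`) there is a level `2 ^ i` such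
that `|S_N| ≥ 2 ^ i` essentially on a set of measure `μ` with `2 ^ i μ ≥ N ^ (τ - 2δ)`. If `h` runs
over the primes up to `H ≈ N ^ (2δ) / μ`, then almost every `α` should have a multiple `hα` in this
set, and such a multiple gives `N D_N(α) ≥ 2 ^ i / H`, which is `N ^ τ` up to a small power of `N`.

That the multiple exists is a second moment estimate. The indicator function of the level set is
replaced by `levelFun`, namely `(1 - (1 - |S_N|² / N²) ^ m) ^ k` with `m ≈ N² / 4 ^ i`, which is a
trigonometric polynomial whose degree is polynomial in `N` because `a_n` grows polynomially. Its
dilates by distinct primes `p`, `q` correlate only through frequencies `pi = qj`, for which `q ∣ i`;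
as a frequency has at most logarithmically many prime divisors, the variance of the sum over the
dilates is, up to logarithms, that of independent variables (`integral_sq_sum_prime_dilates_le`).
With Chebyshev's bound for the number of primes, the exceptional set for `N` has measure at most
`N ^ (-δ)` (`eventually_volume_discrepancy_le`). As `B_L` grows exponentially, the Borel–Cantelli
lemma finishes the proof.
-/

/-! ### Exponential sums and mean values -/

/-- The character `α ↦ e^{2πijα}`. -/
noncomputable def char (j : ℤ) (α : ℝ) : ℂ :=
  Complex.exp (2 * (Real.pi : ℂ) * Complex.I * (j : ℂ) * (α : ℂ))

theorem char_zero (α : ℝ) : char 0 α = 1 := by simp [char]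

theorem char_add (j k : ℤ) (α : ℝ) : char (j + k) α = char j α * char k α := by
  simp only [char, ← Complex.exp_add]; push_cast; ring_nf

theorem char_nat_mul (j : ℤ) (h : ℕ) (α : ℝ) : char j (h * α) = char (h * j) α := by
  simp only [char]; push_cast; ring_nf

theorem conj_char (j : ℤ) (α : ℝ) : (starRingEnd ℂ) (char j α) = char (-j) α := by
  simp only [char, ← Complex.exp_conj]
  simp [Complex.conj_ofNat]

theorem norm_char (j : ℤ) (α : ℝ) : ‖char j α‖ = 1 := by
  have : char j α = Complex.exp ((2 * Real.pi * j * α : ℝ) * Complex.I) := by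
    simp only [char]; push_cast; ring_nf
  rw [this, Complex.norm_exp_ofReal_mul_I]

theorem continuous_char (j : ℤ) : Continuous (char j) := by
  unfold char; fun_prop

theorem char_intCast (j m : ℤ) : char j m = 1 := by
  rw [char, Complex.exp_eq_one_iff]
  exact ⟨j * m, by push_cast; ring⟩

theorem char_add_intCast (j m : ℤ) (α : ℝ) : char j (α + m) = char j α := by
  have : char j (α + m) = char j α * char j m := by
    simp only [char, ← Complex.exp_add]; push_cast; ring_nf
  rw [this, char_intCast, mul_one]

theorem hasDerivAt_char (j : ℤ) (α : ℝ) :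
    HasDerivAt (char j) (2 * Real.pi * Complex.I * j * char j α) α := by
  have h : HasDerivAt (fun x : ℝ => (x : ℂ)) 1 α := Complex.ofRealCLM.hasDerivAt
  have := (h.const_mul (2 * (Real.pi : ℂ) * Complex.I * (j : ℂ))).cexp
  refine this.congr_deriv ?_
  rw [char]; ring

theorem integral_char (j : ℤ) : ∫ α in (0 : ℝ)..1, char j α = if j = 0 then 1 else 0 := by
  split_ifs with h
  · subst h; simp [char_zero]
  · have hc : (2 * Real.pi * Complex.I * j : ℂ) ≠ 0 := by
      simp [Real.pi_ne_zero, h]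
    have h1 := integral_exp_mul_complex (a := 0) (b := 1) hc
    have h2 := char_intCast j 1
    simp only [char] at h2 ⊢
    rw [h1]
    push_cast at h2 ⊢
    rw [h2]; simp

/-- The square mean of an exponential sum whose frequencies need not be distinct. -/
theorem integral_normSq_sum_char {ι : Type*} (s : Finset ι) (ν : ι → ℤ) (w : ι → ℂ) :
    ((∫ α in (0 : ℝ)..1, ‖∑ x ∈ s, w x * char (ν x) α‖ ^ 2 : ℝ) : ℂ) =
      ∑ x ∈ s, ∑ y ∈ s, if ν x = ν y then w x * (starRingEnd ℂ) (w y) else 0 := by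
  have key : ∀ α : ℝ, ((‖∑ x ∈ s, w x * char (ν x) α‖ ^ 2 : ℝ) : ℂ) =
      ∑ x ∈ s, ∑ y ∈ s, w x * (starRingEnd ℂ) (w y) * char (ν x - ν y) α := by
    intro α
    push_cast
    rw [← Complex.mul_conj', map_sum, Finset.sum_mul_sum]
    refine Finset.sum_congr rfl fun x _ => Finset.sum_congr rfl fun y _ => ?_
    rw [map_mul, conj_char, sub_eq_add_neg, char_add]; ring
  have hc : ∀ x y, Continuous fun α : ℝ =>
      w x * (starRingEnd ℂ) (w y) * char (ν x - ν y) α := fun x y =>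
    continuous_const.mul (continuous_char _)
  rw [← intervalIntegral.integral_ofReal]
  simp_rw [key]
  rw [intervalIntegral.integral_finsetSum fun x _ =>
    (continuous_finsetSum s fun y _ => hc x y).intervalIntegrable _ _]
  refine Finset.sum_congr rfl fun x _ => ?_
  rw [intervalIntegral.integral_finsetSum fun y _ => (hc x y).intervalIntegrable _ _]
  refine Finset.sum_congr rfl fun y _ => ?_
  rw [intervalIntegral.integral_const_mul, integral_char]
  simp [sub_eq_zero]

/-- Parseval's identity for trigonometric polynomials. -/
theorem integral_normSq_sum_char_eq (s : Finset ℤ) (c : ℤ → ℂ) :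
    ∫ α in (0 : ℝ)..1, ‖∑ j ∈ s, c j * char j α‖ ^ 2 = ∑ j ∈ s, ‖c j‖ ^ 2 := by
  have h := integral_normSq_sum_char s id c
  simp only [id] at h
  have h2 : ∀ j ∈ s, (∑ y ∈ s, if j = y then c j * (starRingEnd ℂ) (c y) else 0) =
      ((‖c j‖ ^ 2 : ℝ) : ℂ) := by
    intro j hj
    rw [Finset.sum_ite_eq, if_pos hj, Complex.mul_conj']; push_cast; rfl
  rw [Finset.sum_congr rfl h2, ← Complex.ofReal_sum] at h
  exact_mod_cast h

/-- The square mean of an exponential sum is at most the sum of the squared coefficients, each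
weighted by the multiplicity of its frequency. -/
theorem integral_normSq_sum_char_le {ι : Type*} (s : Finset ι) (ν : ι → ℤ) (w : ι → ℂ) :
    ∫ α in (0 : ℝ)..1, ‖∑ x ∈ s, w x * char (ν x) α‖ ^ 2 ≤
      ∑ x ∈ s, ‖w x‖ ^ 2 * ((s.filter fun y => ν y = ν x).card : ℝ) := by
  have h := congrArg Complex.re (integral_normSq_sum_char s ν w)
  rw [Complex.ofReal_re] at h
  rw [h]
  simp only [Complex.re_sum]
  have h1 : ∀ x ∈ s, ∀ y ∈ s, (if ν x = ν y then w x * (starRingEnd ℂ) (w y) else 0 : ℂ).re ≤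
      (if ν x = ν y then ‖w x‖ ^ 2 / 2 else 0) + (if ν y = ν x then ‖w y‖ ^ 2 / 2 else 0) := by
    intro x _ y _
    by_cases hxy : ν x = ν y
    · rw [if_pos hxy, if_pos hxy, if_pos hxy.symm]
      refine (Complex.re_le_norm _).trans ?_
      rw [norm_mul, Complex.norm_conj]
      nlinarith [sq_nonneg (‖w x‖ - ‖w y‖)]
    · rw [if_neg hxy, if_neg hxy, if_neg (Ne.symm hxy)]; simp
  have h2 : ∀ x ∈ s, ‖w x‖ ^ 2 * ((s.filter fun y => ν y = ν x).card : ℝ) =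
      ∑ y ∈ s, ((if ν x = ν y then ‖w x‖ ^ 2 / 2 else 0) +
        if ν x = ν y then ‖w x‖ ^ 2 / 2 else 0) := by
    intro x _
    rw [Finset.card_filter]; push_cast
    rw [Finset.mul_sum]
    refine Finset.sum_congr rfl fun y _ => ?_
    by_cases hxy : ν x = ν y
    · simp [hxy]
    · simp [hxy, Ne.symm hxy]
  rw [Finset.sum_congr rfl h2]
  refine (Finset.sum_le_sum fun x hx => Finset.sum_le_sum fun y hy => h1 x hx y hy).trans ?_
  simp only [Finset.sum_add_distrib]
  exact (add_le_add_right (Finset.sum_comm).le _)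

/-! ### Trigonometric polynomials and their prime dilates -/

/-- The trigonometric polynomials of degree at most `D`. -/
noncomputable def trigPoly (D : ℕ) : Submodule ℂ (ℝ → ℂ) :=
  Submodule.span ℂ (char '' Set.Icc (-(D : ℤ)) D)

theorem char_mem_trigPoly {D : ℕ} {j : ℤ} (h : |j| ≤ D) : char j ∈ trigPoly D :=
  Submodule.subset_span ⟨j, abs_le.mp h, rfl⟩

theorem one_mem_trigPoly (D : ℕ) : (1 : ℝ → ℂ) ∈ trigPoly D := by
  have : char 0 = 1 := funext char_zero
  rw [← this]
  exact char_mem_trigPoly (by simp)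

theorem mul_mem_trigPoly {D E : ℕ} {f g : ℝ → ℂ} (hf : f ∈ trigPoly D) (hg : g ∈ trigPoly E) :
    f * g ∈ trigPoly (D + E) := by
  have h := Submodule.mul_mem_mul hf hg
  rw [trigPoly, trigPoly, Submodule.span_mul_span] at h
  refine Submodule.span_mono ?_ h
  rintro _ ⟨_, ⟨j, hj, rfl⟩, _, ⟨k, hk, rfl⟩, rfl⟩
  rw [Set.mem_Icc] at hj hk
  refine ⟨j + k, ?_, funext fun α => char_add j k α⟩
  rw [Set.mem_Icc]; push_cast; omega

theorem pow_mem_trigPoly {D : ℕ} {f : ℝ → ℂ} (hf : f ∈ trigPoly D) (m : ℕ) :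
    f ^ m ∈ trigPoly (D * m) := by
  induction m with
  | zero => simpa using one_mem_trigPoly _
  | succ m ih => rw [pow_succ, Nat.mul_succ]; exact mul_mem_trigPoly ih hf

theorem exists_coeff_of_mem_trigPoly {D : ℕ} {f : ℝ → ℂ} (hf : f ∈ trigPoly D) :
    ∃ c : ℤ → ℂ, ∀ α, f α = ∑ j ∈ Finset.Icc (-(D : ℤ)) D, c j * char j α := by
  rw [trigPoly, ← Finset.coe_Icc, Submodule.mem_span_image_finset_iff_exists_fun'] at hf
  obtain ⟨c, hc⟩ := hf
  refine ⟨c, fun α => ?_⟩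
  rw [← hc]; simp

theorem continuous_of_mem_trigPoly {D : ℕ} {f : ℝ → ℝ}
    (hf : (fun α => (f α : ℂ)) ∈ trigPoly D) : Continuous f := by
  obtain ⟨c, hc⟩ := exists_coeff_of_mem_trigPoly hf
  have : Continuous fun α => (f α : ℂ) := by
    simp_rw [hc]
    exact continuous_finsetSum _ fun j _ => continuous_const.mul (continuous_char j)
  exact Complex.continuous_re.comp this

theorem card_primeFactors_le_log (n : ℕ) (hn : n ≠ 0) : n.primeFactors.card ≤ Nat.log 2 n := by
  refine Nat.le_log_of_pow_le (by norm_num) ?_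
  calc 2 ^ n.primeFactors.card ≤ ∏ p ∈ n.primeFactors, p :=
        Finset.pow_card_le_prod _ _ _ fun p hp => (Nat.prime_of_mem_primeFactors hp).two_le
    _ ≤ n := Nat.le_of_dvd (Nat.pos_of_ne_zero hn) (Nat.prod_primeFactors_dvd n)

/-- If `p i = q j` with primes `p ≠ q`, then `q` is one of the few prime divisors of `i`. -/
theorem card_prime_mul_eq_le {D : ℕ} (s : Finset ℕ) (hs : ∀ p ∈ s, p.Prime) (J : Finset ℤ)
    {p : ℕ} (hp : p ∈ s) {i : ℤ} (hi0 : i ≠ 0) (hi : i.natAbs ≤ D) :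
    ((s ×ˢ J).filter fun y => (y.1 : ℤ) * y.2 = p * i).card ≤ 1 + Nat.log 2 D := by
  have h1 : ((s ×ˢ J).filter fun y => (y.1 : ℤ) * y.2 = p * i).card ≤
      (insert p i.natAbs.primeFactors).card := by
    refine Finset.card_le_card_of_injOn Prod.fst ?_ ?_
    · rintro ⟨q, j⟩ hy
      simp only [Finset.coe_filter, Finset.mem_product, Set.mem_ofPred_eq] at hy
      obtain ⟨⟨hq, -⟩, h⟩ := hy
      simp only [Finset.coe_insert, Set.mem_insert_iff, Finset.mem_coe, Nat.mem_primeFactors]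
      by_cases hqp : q = p
      · exact Or.inl hqp
      · refine Or.inr ⟨hs q hq, ?_, by simpa using hi0⟩
        have h2 : (q : ℤ) ∣ p * i := ⟨j, h.symm⟩
        have h3 : q ∣ p * i.natAbs := by
          have := Int.natAbs_dvd_natAbs.mpr h2
          simpa [Int.natAbs_mul] using this
        exact (Nat.Coprime.dvd_mul_left ((Nat.coprime_primes (hs q hq) (hs p hp)).mpr hqp)).mp h3
    · rintro ⟨q, j⟩ hy ⟨q', j'⟩ hy' (rfl : q = q')
      simp only [Finset.coe_filter, Finset.mem_product, Set.mem_ofPred_eq] at hy hy'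
      have hq : (q : ℤ) ≠ 0 := by exact_mod_cast (hs q hy.1.1).ne_zero
      have := mul_left_cancel₀ hq (hy.2.trans hy'.2.symm)
      rw [this]
  refine h1.trans ((Finset.card_insert_le _ _).trans ?_)
  have h2 := card_primeFactors_le_log i.natAbs (by simpa using hi0)
  have h3 := Nat.log_mono_right (b := 2) hi
  omega

/-- The dilates of a trigonometric polynomial by distinct primes are nearly uncorrelated, since
each frequency has few prime divisors. -/
theorem integral_sq_sum_prime_dilates_le {D : ℕ} {f : ℝ → ℝ}
    (hf : (fun α => (f α : ℂ)) ∈ trigPoly D) (h0 : ∀ α, 0 ≤ f α) (h1 : ∀ α, f α ≤ 1)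
    (s : Finset ℕ) (hs : ∀ p ∈ s, p.Prime) :
    ∫ α in (0 : ℝ)..1, (∑ p ∈ s, (f (p * α) - ∫ β in (0 : ℝ)..1, f β)) ^ 2 ≤
      s.card * (1 + Nat.log 2 D : ℕ) * ∫ β in (0 : ℝ)..1, f β := by
  obtain ⟨c, hc⟩ := exists_coeff_of_mem_trigPoly hf
  set μ := ∫ β in (0 : ℝ)..1, f β with hμ
  set J := Finset.Icc (-(D : ℤ)) D with hJ
  have h0J : (0 : ℤ) ∈ J := by simp [hJ]
  have hcont : Continuous f := continuous_of_mem_trigPoly hf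
  have hc0 : c 0 = μ := by
    rw [hμ, ← intervalIntegral.integral_ofReal]
    simp_rw [hc]
    have hi : ∀ j ∈ J, IntervalIntegrable (fun α => c j * char j α) MeasureTheory.volume 0 1 :=
      fun j _ => (continuous_const.mul (continuous_char j)).intervalIntegrable _ _
    rw [intervalIntegral.integral_finsetSum hi]
    simp_rw [intervalIntegral.integral_const_mul, integral_char]
    simp [h0J]
  have hpt : ∀ α : ℝ, (∑ p ∈ s, (f (p * α) - μ)) ^ 2 =
      ‖∑ y ∈ s ×ˢ J.erase 0, c y.2 * char (y.1 * y.2) α‖ ^ 2 := by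
    intro α
    rw [← sq_abs, ← Real.norm_eq_abs, ← Complex.norm_real, Finset.sum_product]
    push_cast
    congr 2
    refine Finset.sum_congr rfl fun p _ => ?_
    rw [hc, ← Finset.add_sum_erase _ _ h0J, hc0, char_zero]
    simp only [mul_one, add_sub_cancel_left, char_nat_mul]
  have hsum : ∑ j ∈ J.erase 0, ‖c j‖ ^ 2 ≤ μ := by
    calc ∑ j ∈ J.erase 0, ‖c j‖ ^ 2 ≤ ∑ j ∈ J, ‖c j‖ ^ 2 :=
          Finset.sum_le_sum_of_subset_of_nonneg (Finset.erase_subset _ _)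
            fun _ _ _ => by positivity
      _ = ∫ α in (0 : ℝ)..1, f α ^ 2 := by
          rw [← integral_normSq_sum_char_eq]
          simp_rw [← hc, Complex.norm_real, Real.norm_eq_abs, sq_abs]
      _ ≤ μ := by
          refine intervalIntegral.integral_mono_on zero_le_one
            ((hcont.pow 2).intervalIntegrable _ _) (hcont.intervalIntegrable _ _) fun α _ => ?_
          nlinarith [h0 α, h1 α]
  simp_rw [hpt]
  refine (integral_normSq_sum_char_le (s ×ˢ J.erase 0) (fun y => (y.1 : ℤ) * y.2)
    (fun y => c y.2)).trans ?_
  calc _ ≤ ∑ y ∈ s ×ˢ J.erase 0, ‖c y.2‖ ^ 2 * ((1 + Nat.log 2 D : ℕ) : ℝ) := by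
        refine Finset.sum_le_sum fun y hy => ?_
        rw [Finset.mem_product, Finset.mem_erase, hJ, Finset.mem_Icc] at hy
        refine mul_le_mul_of_nonneg_left ?_ (by positivity)
        exact_mod_cast card_prime_mul_eq_le s hs _ hy.1 hy.2.1 (by omega)
    _ = s.card * (1 + Nat.log 2 D : ℕ) * ∑ j ∈ J.erase 0, ‖c j‖ ^ 2 := by
        rw [← Finset.sum_mul, Finset.sum_product]
        simp only [Finset.sum_const, nsmul_eq_mul]
        ring
    _ ≤ _ := by gcongr

/-- Unless `α` lies in a small set, some prime dilate of `α` is a point where `f` is at least half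
its mean. -/
theorem volume_forall_prime_dilate_lt_le {D : ℕ} {f : ℝ → ℝ}
    (hf : (fun α => (f α : ℂ)) ∈ trigPoly D) (h0 : ∀ α, 0 ≤ f α) (h1 : ∀ α, f α ≤ 1)
    (hμ : 0 < ∫ β in (0 : ℝ)..1, f β)
    (s : Finset ℕ) (hs : ∀ p ∈ s, p.Prime) (hs0 : s.Nonempty) :
    MeasureTheory.volume.restrict (Set.Ico (0 : ℝ) 1)
        {α | ∀ p ∈ s, f (p * α) < (∫ β in (0 : ℝ)..1, f β) / 2} ≤
      ENNReal.ofReal (4 * (1 + Nat.log 2 D : ℕ) / (s.card * ∫ β in (0 : ℝ)..1, f β)) := by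
  have hcont : Continuous f := continuous_of_mem_trigPoly hf
  have hvar := integral_sq_sum_prime_dilates_le hf h0 h1 s hs
  set μ := ∫ β in (0 : ℝ)..1, f β
  set Y : ℝ → ℝ := fun α => (∑ p ∈ s, (f (p * α) - μ)) ^ 2 with hY
  have hYc : Continuous Y := by
    refine (continuous_finsetSum _ fun p _ => ?_).pow 2
    exact (hcont.comp (continuous_const.mul continuous_id)).sub continuous_const
  have hP : (0 : ℝ) < s.card := by exact_mod_cast hs0.card_pos
  have hsub : {α | ∀ p ∈ s, f (p * α) < μ / 2} ⊆ {α | (s.card * μ / 2) ^ 2 ≤ Y α} := by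
    intro α hα
    have : ∑ p ∈ s, (f (p * α) - μ) ≤ ∑ p ∈ s, (-(μ / 2)) :=
      Finset.sum_le_sum fun p hp => by have := hα p hp; linarith
    rw [Finset.sum_const, nsmul_eq_mul] at this
    have h3 : 0 < s.card * μ := by positivity
    simp only [Set.mem_ofPred_eq, hY]
    nlinarith
  have hint : MeasureTheory.Integrable Y (MeasureTheory.volume.restrict (Set.Ico (0 : ℝ) 1)) :=
    (hYc.integrableOn_Icc (a := 0) (b := 1)).mono_set Set.Ico_subset_Icc_self
  have hmk := MeasureTheory.mul_meas_ge_le_integral_of_nonneg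
    (μ := MeasureTheory.volume.restrict (Set.Ico (0 : ℝ) 1)) (f := Y)
    (Filter.Eventually.of_forall fun α => sq_nonneg _) hint ((s.card * μ / 2) ^ 2)
  have hI : ∫ α, Y α ∂(MeasureTheory.volume.restrict (Set.Ico (0 : ℝ) 1)) =
      ∫ α in (0 : ℝ)..1, Y α := by
    rw [intervalIntegral.integral_of_le zero_le_one, MeasureTheory.integral_Ico_eq_integral_Ioc]
  rw [hI] at hmk
  refine (MeasureTheory.measure_mono hsub).trans ?_
  rw [← ENNReal.ofReal_toReal (MeasureTheory.measure_ne_top _ _)]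
  refine ENNReal.ofReal_le_ofReal ?_
  change MeasureTheory.Measure.real _ _ ≤ _
  rw [le_div_iff₀ (by positivity)]
  have h4 := hmk.trans hvar
  have h5 : 0 < s.card * μ := by positivity
  refine le_of_mul_le_mul_left ?_ h5
  nlinarith

/-! ### Koksma's inequality -/

theorem abs_countInInterval_sub_le (x : ℕ → ℝ) {N : ℕ} (hN : 0 < N) {u : ℝ} (hu0 : 0 < u)
    (hu1 : u ≤ 1) : |(N : ℝ) * u - countInInterval x N 0 u| ≤ N * discrepancy x N := by
  have hN' : (0 : ℝ) < N := by exact_mod_cast hN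
  have hbdd : BddAbove {r : ℝ | ∃ a b : ℝ, 0 ≤ a ∧ a < b ∧ b ≤ 1 ∧
      r = |(countInInterval x N a b : ℝ) / (N : ℝ) - (b - a)|} := by
    refine ⟨1, ?_⟩
    rintro r ⟨a, b, ha, hab, hb, rfl⟩
    have h1 : (countInInterval x N a b : ℝ) ≤ N := by
      have : countInInterval x N a b ≤ N := by
        unfold countInInterval
        exact (Finset.card_filter_le _ _).trans (by simp)
      exact_mod_cast this
    have h2 : (countInInterval x N a b : ℝ) / N ≤ 1 := (div_le_one hN').mpr h1
    have h3 : 0 ≤ (countInInterval x N a b : ℝ) / N := by positivity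
    rw [abs_le]; constructor <;> linarith
  have hle : |(countInInterval x N 0 u : ℝ) / (N : ℝ) - (u - 0)| ≤ discrepancy x N :=
    le_csSup hbdd ⟨0, u, le_rfl, hu0, hu1, rfl⟩
  calc |(N : ℝ) * u - countInInterval x N 0 u|
      = N * |(countInInterval x N 0 u : ℝ) / (N : ℝ) - (u - 0)| := by
        rw [← abs_of_pos hN', ← abs_mul, abs_of_pos hN', abs_sub_comm]
        congr 1; field_simp; ring
    _ ≤ _ := by gcongr

theorem continuous_const_mul_char (z : ℂ) (j : ℤ) : Continuous fun α => z * char j α :=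
  continuous_const.mul (continuous_char j)

theorem char_one (j : ℤ) : char j 1 = 1 := by simpa using char_intCast j 1

/-- The values of a character as an integral over `[0, 1]`, in the form that turns a sum over points
into an integral over their counting function. -/
theorem char_eq_one_sub_integral (j : ℤ) {y : ℝ} (hy0 : 0 ≤ y) (hy1 : y ≤ 1) :
    char j y = 1 - ∫ u in (0 : ℝ)..1,
      if y < u then 2 * Real.pi * Complex.I * j * char j u else 0 := by
  have h1 : ∫ u in y..1, 2 * Real.pi * Complex.I * j * char j u = char j 1 - char j y :=
    intervalIntegral.integral_eq_sub_of_hasDerivAt (fun u _ => hasDerivAt_char j u)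
      ((continuous_const_mul_char _ j).intervalIntegrable _ _)
  have h2 : (∫ u in (0 : ℝ)..1, if y < u then 2 * Real.pi * Complex.I * j * char j u else 0) =
      ∫ u in y..1, 2 * Real.pi * Complex.I * j * char j u := by
    rw [intervalIntegral.integral_of_le zero_le_one, intervalIntegral.integral_of_le hy1]
    have hs : Set.Ioc y 1 = Set.Ioc 0 1 ∩ Set.Ioi y := by
      ext u; simp only [Set.mem_Ioc, Set.mem_inter_iff, Set.mem_Ioi]
      exact ⟨fun h => ⟨⟨hy0.trans_lt h.1, h.2⟩, h.1⟩, fun h => ⟨h.2, h.1.2⟩⟩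
    rw [hs, ← MeasureTheory.setIntegral_indicator measurableSet_Ioi]
    rfl
  rw [h2, h1, char_one]; ring

theorem integral_mul_deriv_char {j : ℤ} (hj : j ≠ 0) :
    ∫ u in (0 : ℝ)..1, (u : ℂ) * (2 * Real.pi * Complex.I * j * char j u) = 1 := by
  rw [intervalIntegral.integral_mul_deriv_eq_deriv_mul (u := fun u : ℝ => (u : ℂ))
    (u' := fun _ => 1) (v := char j)
    (fun u _ => Complex.ofRealCLM.hasDerivAt) (fun u _ => hasDerivAt_char j u)
    (continuous_const.intervalIntegrable _ _)
    ((continuous_const_mul_char _ j).intervalIntegrable _ _)]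
  simp [char_one, integral_char, hj]

/-- Koksma's inequality for the function `u ↦ e^{2πihu}`. -/
theorem norm_sum_char_le_discrepancy {x : ℕ → ℝ} (hx0 : ∀ n, 0 ≤ x n) (hx1 : ∀ n, x n < 1)
    {N : ℕ} (hN : 0 < N) {h : ℕ} (hh : 0 < h) :
    ‖∑ n ∈ Finset.Icc 1 N, char h (x n)‖ ≤ 2 * Real.pi * h * (N * discrepancy x N) := by
  set g : ℝ → ℂ := fun u => 2 * Real.pi * Complex.I * (h : ℤ) * char h u with hg
  have hgc : Continuous g := continuous_const_mul_char _ _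
  have hint : ∀ n ∈ Finset.Icc 1 N, IntervalIntegrable (fun u => if x n < u then g u else 0)
      MeasureTheory.volume 0 1 := by
    intro n _
    rw [intervalIntegrable_iff_integrableOn_Ioc_of_le zero_le_one]
    exact MeasureTheory.Integrable.indicator (s := Set.Ioi (x n))
      ((hgc.integrableOn_Icc (a := 0) (b := 1)).mono_set Set.Ioc_subset_Icc_self)
      measurableSet_Ioi
  have hug : Continuous fun u : ℝ => (u : ℂ) * g u := Complex.continuous_ofReal.mul hgc
  have hrep : ∑ n ∈ Finset.Icc 1 N, char h (x n) =
      ∫ u in (0 : ℝ)..1, ((N : ℂ) * ((u : ℂ) * g u) -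
        ∑ n ∈ Finset.Icc 1 N, if x n < u then g u else 0) := by
    have hi1 : IntervalIntegrable (fun u : ℝ => (N : ℂ) * ((u : ℂ) * g u))
        MeasureTheory.volume 0 1 := (continuous_const.mul hug).intervalIntegrable _ _
    have hi2 : IntervalIntegrable (fun u => ∑ n ∈ Finset.Icc 1 N, if x n < u then g u else 0)
        MeasureTheory.volume 0 1 := by
      have := IntervalIntegrable.sum _ hint
      rwa [Finset.sum_fn] at this
    rw [intervalIntegral.integral_sub hi1 hi2,
      intervalIntegral.integral_const_mul, integral_mul_deriv_char (by exact_mod_cast hh.ne'),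
      intervalIntegral.integral_finsetSum hint,
      Finset.sum_congr rfl fun n _ => char_eq_one_sub_integral h (hx0 n) (hx1 n).le,
      Finset.sum_sub_distrib]
    simp [hg]
  rw [hrep]
  have hb := intervalIntegral.norm_integral_le_of_norm_le_const (a := 0) (b := 1)
    (C := 2 * Real.pi * h * (N * discrepancy x N))
    (f := fun u => (N : ℂ) * ((u : ℂ) * g u) -
        ∑ n ∈ Finset.Icc 1 N, if x n < u then g u else 0) ?_
  · simpa using hb
  · intro u hu
    rw [Set.uIoc_of_le zero_le_one, Set.mem_Ioc] at hu
    have hcount : (∑ n ∈ Finset.Icc 1 N, if x n < u then g u else 0) =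
        (countInInterval x N 0 u : ℂ) * g u := by
      rw [← Finset.sum_filter, Finset.sum_const, nsmul_eq_mul]
      congr 2
      unfold countInInterval
      congr 1
      ext n
      simp [hx0 n]
    have hnorm : ‖g u‖ = 2 * Real.pi * h := by
      simp only [hg, norm_mul, norm_char]
      simp [abs_of_pos Real.pi_pos]
    have heq : (N : ℂ) * ((u : ℂ) * g u) - (countInInterval x N 0 u : ℂ) * g u =
        (((N : ℝ) * u - countInInterval x N 0 u : ℝ) : ℂ) * g u := by
      push_cast; ring
    rw [hcount, heq, norm_mul, Complex.norm_real, Real.norm_eq_abs, hnorm, mul_comm]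
    exact mul_le_mul_of_nonneg_left (abs_countInInterval_sub_le x hN hu.1 hu.2) (by positivity)

/-! ### Level functions of exponential sums -/

/-- The exponential sum `∑_{n ≤ N} e^{2πi a_n α}`. -/
noncomputable def expSum (a : ℕ → ℤ) (N : ℕ) (α : ℝ) : ℂ :=
  ∑ n ∈ Finset.Icc 1 N, char (a n) α

theorem norm_expSum_le (a : ℕ → ℤ) (N : ℕ) (α : ℝ) : ‖expSum a N α‖ ≤ N := by
  refine (norm_sum_le _ _).trans ?_
  simp [norm_char]

theorem continuous_expSum (a : ℕ → ℤ) (N : ℕ) : Continuous (expSum a N) :=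
  continuous_finsetSum _ fun n _ => continuous_char (a n)

/-- The exponential sum at a multiple `pα` is controlled by the discrepancy at `α`. -/
theorem norm_expSum_nat_mul_le (a : ℕ → ℤ) {N : ℕ} (hN : 0 < N) (α : ℝ) {p : ℕ} (hp : 0 < p) :
    ‖expSum a N (p * α)‖ ≤
      2 * Real.pi * p * (N * discrepancy (fun n => Int.fract ((a n : ℝ) * α)) N) := by
  have h := norm_sum_char_le_discrepancy (x := fun n => Int.fract ((a n : ℝ) * α))
    (fun n => Int.fract_nonneg _) (fun n => Int.fract_lt_one _) hN hp
  convert h using 2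
  refine Finset.sum_congr rfl fun n _ => ?_
  have h1 : char p (Int.fract ((a n : ℝ) * α)) = char p ((a n : ℝ) * α) := by
    rw [← char_add_intCast p ⌊(a n : ℝ) * α⌋ (Int.fract ((a n : ℝ) * α)), Int.fract_add_floor]
  refine Eq.trans ?_ h1.symm
  simp only [char]
  push_cast; ring_nf

theorem normSq_expSum_mem_trigPoly {a : ℕ → ℤ} {N A : ℕ}
    (ha : ∀ n ∈ Finset.Icc 1 N, |a n| ≤ A) :
    (fun α => ((‖expSum a N α‖ ^ 2 : ℝ) : ℂ)) ∈ trigPoly (A + A) := by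
  have h1 : (∑ n ∈ Finset.Icc 1 N, char (a n)) ∈ trigPoly A :=
    Submodule.sum_mem _ fun n hn => char_mem_trigPoly (ha n hn)
  have h2 : (∑ n ∈ Finset.Icc 1 N, char (-a n)) ∈ trigPoly A :=
    Submodule.sum_mem _ fun n hn => char_mem_trigPoly (by rw [abs_neg]; exact ha n hn)
  convert mul_mem_trigPoly h1 h2 using 1
  funext α
  push_cast
  rw [← Complex.mul_conj', expSum, map_sum]
  simp [conj_char]

/-- A trigonometric polynomial with values in `[0, 1]` that approximates the indicator function
of the set where `|S_N| ≥ N / √m`: it is bounded below on this set, and small of order `k` in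
`m |S_N|² / N²` away from it. -/
noncomputable def levelFun (a : ℕ → ℤ) (N m k : ℕ) (α : ℝ) : ℝ :=
  (1 - (1 - ‖expSum a N α‖ ^ 2 / (N : ℝ) ^ 2) ^ m) ^ k

theorem levelFun_mem_trigPoly {a : ℕ → ℤ} {N A : ℕ} (ha : ∀ n ∈ Finset.Icc 1 N, |a n| ≤ A)
    (m k : ℕ) : (fun α => (levelFun a N m k α : ℂ)) ∈ trigPoly ((A + A) * m * k) := by
  have h1 := normSq_expSum_mem_trigPoly ha
  have h2 := Submodule.smul_mem _ (((N : ℂ) ^ 2)⁻¹) h1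
  have h3 := pow_mem_trigPoly (Submodule.sub_mem _ (one_mem_trigPoly _) h2) m
  have h4 := pow_mem_trigPoly (Submodule.sub_mem _ (one_mem_trigPoly _) h3) k
  convert h4 using 1
  funext α
  simp only [levelFun, Pi.pow_apply, Pi.sub_apply, Pi.one_apply, Pi.smul_apply, smul_eq_mul]
  push_cast
  rw [div_eq_inv_mul]

section levelFun

variable (a : ℕ → ℤ) {N : ℕ} (m k : ℕ) (α : ℝ)

theorem normSq_div_le_one : ‖expSum a N α‖ ^ 2 / (N : ℝ) ^ 2 ≤ 1 :=
  div_le_one_of_le₀ (pow_le_pow_left₀ (norm_nonneg _) (norm_expSum_le a N α) 2) (by positivity)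

theorem levelFun_base_nonneg : 0 ≤ 1 - (1 - ‖expSum a N α‖ ^ 2 / (N : ℝ) ^ 2) ^ m := by
  have h1 := normSq_div_le_one a (N := N) α
  have h0 : 0 ≤ ‖expSum a N α‖ ^ 2 / (N : ℝ) ^ 2 := by positivity
  exact sub_nonneg.mpr (pow_le_one₀ (by linarith) (by linarith))

theorem levelFun_nonneg : 0 ≤ levelFun a N m k α :=
  pow_nonneg (levelFun_base_nonneg a m α) k

theorem levelFun_le_one : levelFun a N m k α ≤ 1 := by
  refine pow_le_one₀ (levelFun_base_nonneg a m α) ?_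
  have h1 := normSq_div_le_one a (N := N) α
  have : 0 ≤ (1 - ‖expSum a N α‖ ^ 2 / (N : ℝ) ^ 2) ^ m := pow_nonneg (by linarith) m
  linarith

theorem levelFun_le : levelFun a N m k α ≤ (m * (‖expSum a N α‖ ^ 2 / (N : ℝ) ^ 2)) ^ k := by
  refine pow_le_pow_left₀ (levelFun_base_nonneg a m α) ?_ k
  have h1 := normSq_div_le_one a (N := N) α
  have := one_add_mul_le_pow (a := -(‖expSum a N α‖ ^ 2 / (N : ℝ) ^ 2)) (by linarith) m
  rw [← sub_eq_add_neg 1] at this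
  linarith

theorem one_le_two_pow_mul_levelFun (h : 1 ≤ m * (‖expSum a N α‖ ^ 2 / (N : ℝ) ^ 2)) :
    1 ≤ 2 ^ k * levelFun a N m k α := by
  rw [levelFun, ← mul_pow]
  refine one_le_pow₀ ?_
  set x := ‖expSum a N α‖ ^ 2 / (N : ℝ) ^ 2
  have h1 : x ≤ 1 := normSq_div_le_one a (N := N) α
  have h2 : (1 - x) ^ m ≤ Real.exp (-1) := by
    calc (1 - x) ^ m ≤ (Real.exp (-x)) ^ m :=
          pow_le_pow_left₀ (by linarith) (Real.one_sub_le_exp_neg x) m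
      _ = Real.exp (-(m * x)) := by rw [← Real.exp_nat_mul]; ring_nf
      _ ≤ _ := Real.exp_le_exp.mpr (by linarith)
  have h3 : Real.exp (-1) ≤ 1 / 2 := by
    rw [Real.exp_neg, ← one_div]
    refine one_div_le_one_div_of_le two_pos ?_
    have := Real.add_one_le_exp (1 : ℝ)
    linarith
  linarith

end levelFun

/-- The exponent that makes `levelFun` detect the level `|S_N| ≥ 2 ^ i`. -/
noncomputable def levelExp (N i : ℕ) : ℕ := ⌈(N : ℝ) ^ 2 / 4 ^ i⌉₊

theorem le_levelExp (N i : ℕ) : (N : ℝ) ^ 2 ≤ levelExp N i * 4 ^ i := by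
  rw [← div_le_iff₀ (by positivity)]; exact Nat.le_ceil _

theorem levelExp_le {N i : ℕ} (h : 2 ^ i ≤ N) : (levelExp N i : ℝ) * 4 ^ i ≤ 2 * (N : ℝ) ^ 2 := by
  have h1 : (4 : ℝ) ^ i ≤ (N : ℝ) ^ 2 := by
    have : (2 : ℝ) ^ i ≤ N := by exact_mod_cast h
    calc (4 : ℝ) ^ i = (2 ^ i) ^ 2 := by rw [← pow_mul, mul_comm, pow_mul]; norm_num
      _ ≤ _ := pow_le_pow_left₀ (by positivity) this 2
  have h2 : (levelExp N i : ℝ) < (N : ℝ) ^ 2 / 4 ^ i + 1 := Nat.ceil_lt_add_one (by positivity)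
  have h4 : (0 : ℝ) < 4 ^ i := by positivity
  calc (levelExp N i : ℝ) * 4 ^ i ≤ ((N : ℝ) ^ 2 / 4 ^ i + 1) * 4 ^ i := by gcongr
    _ = (N : ℝ) ^ 2 + 4 ^ i := by field_simp
    _ ≤ _ := by linarith

/-- Dyadic decomposition of `|S_N|` into its level sets. -/
theorem norm_expSum_le_sum_levelFun (a : ℕ → ℤ) {N : ℕ} (hN : 0 < N) (k : ℕ) (α : ℝ) :
    ‖expSum a N α‖ ≤ 1 + ∑ i ∈ Finset.range (Nat.log 2 N + 1),
      2 ^ (k + 1) * (2 ^ i * levelFun a N (levelExp N i) k α) := by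
  have hterm : ∀ i ∈ Finset.range (Nat.log 2 N + 1),
      0 ≤ 2 ^ (k + 1) * (2 ^ i * levelFun a N (levelExp N i) k α) := fun i _ => by
    have := levelFun_nonneg a (N := N) (levelExp N i) k α
    positivity
  set s := ‖expSum a N α‖ with hs
  rcases lt_or_ge s 1 with h | h
  · have := Finset.sum_nonneg hterm
    linarith
  · set i := Nat.log 2 ⌊s⌋₊ with hi
    have hfl : ⌊s⌋₊ ≠ 0 := (Nat.floor_pos.mpr h).ne'
    have h1 : (2 : ℝ) ^ i ≤ s := by
      have : 2 ^ i ≤ ⌊s⌋₊ := Nat.pow_log_le_self 2 hfl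
      exact le_trans (by exact_mod_cast this) (Nat.floor_le (by linarith))
    have h2 : s < 2 ^ (i + 1) := by
      have : ⌊s⌋₊ < 2 ^ (i + 1) := Nat.lt_pow_succ_log_self (by norm_num) _
      have := (Nat.floor_lt (by linarith)).mp this
      exact_mod_cast this
    have h3 : i ∈ Finset.range (Nat.log 2 N + 1) := by
      rw [Finset.mem_range, Nat.lt_succ_iff]
      exact Nat.log_mono_right (Nat.floor_le_of_le (norm_expSum_le a N α))
    have hone : 1 ≤ 2 ^ k * levelFun a N (levelExp N i) k α := by
      refine one_le_two_pow_mul_levelFun a _ k α ?_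
      have hNp : (0 : ℝ) < (N : ℝ) ^ 2 := by positivity
      rw [← mul_div_assoc, le_div_iff₀ hNp, one_mul]
      refine (le_levelExp N i).trans ?_
      gcongr
      calc (4 : ℝ) ^ i = (2 ^ i) ^ 2 := by rw [← pow_mul, mul_comm, pow_mul]; norm_num
        _ ≤ _ := pow_le_pow_left₀ (by positivity) h1 2
    have h4 := Finset.single_le_sum hterm h3
    have h5 : (2 : ℝ) ^ (i + 1) ≤ 2 ^ (k + 1) * (2 ^ i * levelFun a N (levelExp N i) k α) := by
      calc (2 : ℝ) ^ (i + 1) = 2 ^ (i + 1) * 1 := by ring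
        _ ≤ 2 ^ (i + 1) * (2 ^ k * levelFun a N (levelExp N i) k α) := by gcongr
        _ = _ := by ring
    linarith

theorem continuous_levelFun (a : ℕ → ℤ) (N m k : ℕ) : Continuous (levelFun a N m k) := by
  have := continuous_expSum a N
  unfold levelFun
  fun_prop

/-- A large first moment of `|S_N|` is due, up to a logarithm, to one dyadic level. -/
theorem exists_level (a : ℕ → ℤ) {N : ℕ} (hN : 0 < N) (k : ℕ) {T : ℝ}
    (h : 1 + (Nat.log 2 N + 1) * (2 ^ (k + 1) * T) < ∫ α in (0 : ℝ)..1, ‖expSum a N α‖) :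
    ∃ i, 2 ^ i ≤ N ∧
      T ≤ 2 ^ i * ∫ α in (0 : ℝ)..1, levelFun a N (levelExp N i) k α := by
  by_contra! hcon
  have hcont : ∀ i, Continuous fun α =>
      2 ^ (k + 1) * (2 ^ i * levelFun a N (levelExp N i) k α) := fun i =>
    continuous_const.mul (continuous_const.mul (continuous_levelFun a N _ k))
  have h1 : ∫ α in (0 : ℝ)..1, ‖expSum a N α‖ ≤
      ∫ α in (0 : ℝ)..1, (1 + ∑ i ∈ Finset.range (Nat.log 2 N + 1),
        2 ^ (k + 1) * (2 ^ i * levelFun a N (levelExp N i) k α)) := by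
    refine intervalIntegral.integral_mono_on zero_le_one
      ((continuous_expSum a N).norm.intervalIntegrable _ _) ?_
      fun α _ => norm_expSum_le_sum_levelFun a hN k α
    exact (continuous_const.add
      (continuous_finsetSum _ fun i _ => hcont i)).intervalIntegrable _ _
  rw [intervalIntegral.integral_add (continuous_const.intervalIntegrable _ _)
    ((continuous_finsetSum _ fun i _ => hcont i).intervalIntegrable _ _),
    intervalIntegral.integral_finsetSum fun i _ => (hcont i).intervalIntegrable _ _] at h1
  simp_rw [intervalIntegral.integral_const_mul] at h1
  have h2 : ∑ i ∈ Finset.range (Nat.log 2 N + 1),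
      (2 : ℝ) ^ (k + 1) * (2 ^ i * ∫ α in (0 : ℝ)..1, levelFun a N (levelExp N i) k α) ≤
      ∑ i ∈ Finset.range (Nat.log 2 N + 1), 2 ^ (k + 1) * T := by
    refine Finset.sum_le_sum fun i hi => ?_
    have hi2 : 2 ^ i ≤ N := (Nat.pow_le_pow_right (by norm_num)
      (Nat.lt_succ_iff.mp (Finset.mem_range.mp hi))).trans (Nat.pow_log_le_self 2 hN.ne')
    have := (hcon i hi2).le
    gcongr
  rw [Finset.sum_const, Finset.card_range, nsmul_eq_mul] at h2
  push_cast at h2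
  simp only [intervalIntegral.integral_const, sub_zero, smul_eq_mul, mul_one] at h1
  linarith

/-! ### The exceptional set for one `N` -/

open Filter

theorem eventually_mul_one_add_log_le (C : ℝ) {δ : ℝ} (hδ : 0 < δ) :
    ∀ᶠ N : ℕ in atTop, C * (1 + Real.log N) ≤ (N : ℝ) ^ δ := by
  have h1 : (fun x : ℝ => C * (1 + Real.log x)) =o[atTop] fun x => x ^ δ := by
    refine Asymptotics.IsLittleO.const_mul_left ?_ C
    refine Asymptotics.IsLittleO.add ?_ (isLittleO_log_rpow_atTop hδ)
    rw [Asymptotics.isLittleO_const_left]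
    exact Or.inr (tendsto_norm_atTop_atTop.comp (tendsto_rpow_atTop hδ))
  have h2 := tendsto_natCast_atTop_atTop.eventually (h1.bound one_pos)
  filter_upwards [h2] with N hN
  rw [one_mul, Real.norm_of_nonneg (by positivity : (0 : ℝ) ≤ (N : ℝ) ^ δ)] at hN
  exact (Real.le_norm_self _).trans hN

theorem natLog_two_le {n : ℕ} (hn : 0 < n) : (Nat.log 2 n : ℝ) ≤ 2 * Real.log n := by
  have h1 : ((2 : ℝ)) ^ Nat.log 2 n ≤ n := by exact_mod_cast Nat.pow_log_le_self 2 hn.ne'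
  have h2 := Real.log_le_log (by positivity) h1
  rw [Real.log_pow] at h2
  have h3 := Real.log_two_gt_d9
  have h4 : (0 : ℝ) ≤ Nat.log 2 n := by positivity
  nlinarith

/-- Chebyshev's lower bound for the number of primes. -/
theorem eventually_le_card_primesLE_mul_log :
    ∀ᶠ H : ℕ in atTop, (H : ℝ) ≤ 2 * (Nat.primesLE H).card * Real.log H := by
  have h := eventually_mul_one_add_log_le 10 (δ := 1) one_pos
  filter_upwards [h, eventually_ge_atTop 2] with H hH h2
  rw [Real.rpow_one] at hH
  have h2' : (2 : ℝ) ≤ H := by exact_mod_cast h2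
  have hlog : 0 < Real.log H := Real.log_pos (by linarith)
  have h3 := Chebyshev.pi_ge H
  rw [div_le_iff₀ hlog] at h3
  rw [Nat.primesLE_card_eq_primeCounting]
  have h4 : Real.log (H + 1) ≤ Real.log 2 + Real.log H := by
    rw [← Real.log_mul (by norm_num) (by positivity)]
    exact Real.log_le_log (by positivity) (by linarith)
  have h5 := Real.log_two_gt_d9
  have h6 := Real.log_two_lt_d9
  nlinarith

/-- The level function with exponent `levelExp N i` is negligible unless `|S_N|` is nearly as
large as `2 ^ i`. -/
theorem le_norm_expSum_of_le_levelFun {a : ℕ → ℤ} {N i k : ℕ} {X μ α : ℝ} (hN : 3 ≤ N)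
    (hX : 1 ≤ X) (hXk : (N : ℝ) ≤ X ^ k) (hiN : 2 ^ i ≤ N) (hμ : 1 ≤ N * μ)
    (h : μ / 2 ≤ levelFun a N (levelExp N i) k α) : 2 ^ i / (2 * X) ≤ ‖expSum a N α‖ := by
  by_contra! hlt
  have hx : (3 : ℝ) ≤ N := by exact_mod_cast hN
  have hx0 : (0 : ℝ) < N := by linarith
  have hX0 : 0 < X := by linarith
  have hm : (levelExp N i : ℝ) * (‖expSum a N α‖ ^ 2 / (N : ℝ) ^ 2) ≤ 1 / X ^ 2 := by
    have h1 : ‖expSum a N α‖ ^ 2 ≤ (2 ^ i / (2 * X)) ^ 2 :=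
      pow_le_pow_left₀ (norm_nonneg _) hlt.le 2
    have h2 : ((2 : ℝ) ^ i / (2 * X)) ^ 2 = 4 ^ i / (4 * X ^ 2) := by
      rw [div_pow, ← pow_mul, mul_comm i, pow_mul]; ring
    rw [h2] at h1
    rw [← mul_div_assoc, div_le_div_iff₀ (by positivity) (by positivity), one_mul]
    calc (levelExp N i : ℝ) * ‖expSum a N α‖ ^ 2 * X ^ 2
        ≤ (levelExp N i : ℝ) * (4 ^ i / (4 * X ^ 2)) * X ^ 2 := by gcongr
      _ = (levelExp N i : ℝ) * 4 ^ i / 4 := by field_simp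
      _ ≤ (2 * (N : ℝ) ^ 2) / 4 := div_le_div_of_nonneg_right (levelExp_le hiN) (by norm_num)
      _ ≤ (N : ℝ) ^ 2 := by nlinarith
  have h3 := h.trans (levelFun_le a (levelExp N i) k α)
  have h4 := h3.trans (pow_le_pow_left₀ (by positivity) hm k)
  have h5 : (1 / X ^ 2) ^ k ≤ 1 / (N : ℝ) ^ 2 := by
    rw [div_pow, one_pow, ← pow_mul, mul_comm, pow_mul]
    gcongr
  have h6 := h4.trans h5
  rw [le_div_iff₀ (by positivity)] at h6
  nlinarith

/-- A level function of order `k` has a degree polynomial in `N`, so a logarithm that is negligible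
against powers of `N`. -/
theorem log_degree_le {N k m : ℕ} (hN : 0 < N) (hk : 4 * k ≤ N) (hm : m ≤ 2 * N ^ 2) (t : ℕ) :
    (1 + Nat.log 2 ((N ^ t + N ^ t) * m * k) : ℝ) ≤ 2 * (t + 4) * (1 + Real.log N) := by
  have h2 : (N ^ t + N ^ t) * m * k ≤ N ^ (t + 3) := by
    calc (N ^ t + N ^ t) * m * k ≤ (N ^ t + N ^ t) * (2 * N ^ 2) * k := by gcongr
      _ = N ^ t * N ^ 2 * (4 * k) := by ring
      _ ≤ N ^ t * N ^ 2 * N := by gcongr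
      _ = N ^ (t + 3) := by ring
  have h3 : (Nat.log 2 ((N ^ t + N ^ t) * m * k) : ℝ) ≤ Nat.log 2 (N ^ (t + 3)) := by
    exact_mod_cast Nat.log_mono_right h2
  have h4 := natLog_two_le (n := N ^ (t + 3)) (by positivity)
  push_cast at h4
  rw [Real.log_pow] at h4
  push_cast at h4
  have h5 : (0 : ℝ) ≤ t := by positivity
  have h6 : 0 ≤ Real.log N := Real.log_natCast_nonneg N
  linarith [mul_nonneg h5 h6]

set_option maxHeartbeats 400000 in
/-- If `|S_N|` has a large mean, then outside a small set of `α` the discrepancy is large. -/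
theorem eventually_volume_discrepancy_le (t : ℕ) {τ δ : ℝ} (hδ0 : 0 < δ) (hδ : δ ≤ 1 / 2)
    (hδτ : 2 * δ ≤ τ) :
    ∀ᶠ N : ℕ in atTop, ∀ a : ℕ → ℤ, (∀ n ∈ Finset.Icc 1 N, |a n| ≤ (N : ℤ) ^ t) →
      (N : ℝ) ^ (τ - δ) < (∫ α in (0 : ℝ)..1, ‖expSum a N α‖) →
      MeasureTheory.volume.restrict (Set.Ico (0 : ℝ) 1)
        {α | (N : ℝ) * discrepancy (fun n => Int.fract ((a n : ℝ) * α)) N ≤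
          (N : ℝ) ^ (τ - 6 * δ)} ≤ ENNReal.ofReal ((N : ℝ) ^ (-δ)) := by
  -- `N ≤ N ^ (kδ)`: the order `k` makes `levelFun` less than `μ / 2` where `|S_N|` is far below the
  -- level
  obtain ⟨k, hk⟩ := exists_nat_ge (1 / δ)
  have hkδ : 1 ≤ k * δ := (div_le_iff₀ hδ0).mp hk
  obtain ⟨H₀, hH₀⟩ := eventually_atTop.mp eventually_le_card_primesLE_mul_log
  filter_upwards [eventually_ge_atTop 3, eventually_ge_atTop (4 * k),
    eventually_mul_one_add_log_le (1 + 2 ^ (k + 1) * 2) hδ0,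
    eventually_mul_one_add_log_le (H₀ + 8 * Real.pi + 1) hδ0,
    eventually_mul_one_add_log_le (24 * (2 * (t + 4))) (half_pos hδ0),
    eventually_mul_one_add_log_le 1 (half_pos hδ0)]
    with N hN3 hN4 hlog1 hlog2 hlog3 hlog4 a ha hmean
  have hN0 : 0 < N := by omega
  have hx2 : (2 : ℝ) ≤ N := by exact_mod_cast (by omega : 2 ≤ N)
  have hx0 : (0 : ℝ) < N := by linarith
  have hx1 : (1 : ℝ) ≤ N := by linarith
  have hl0 : 0 < Real.log N := Real.log_pos (by linarith)
  set X : ℝ := (N : ℝ) ^ δ with hX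
  have hX0 : 0 < X := Real.rpow_pos_of_pos hx0 _
  have hX1 : 1 ≤ X := Real.one_le_rpow hx1 hδ0.le
  set T : ℝ := (N : ℝ) ^ (τ - 2 * δ) with hT
  have hT1 : 1 ≤ T := Real.one_le_rpow hx1 (by linarith)
  have hTX : T * X = (N : ℝ) ^ (τ - δ) := by
    rw [hT, hX, ← Real.rpow_add hx0]; ring_nf
  -- a dyadic level that carries the mean, up to the loss `X = N ^ δ`
  obtain ⟨i, hiN, hi⟩ := exists_level a hN0 k (T := T) (by
    refine lt_of_le_of_lt ?_ hmean
    rw [← hTX]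
    have h1 := natLog_two_le hN0
    have h2 : (0 : ℝ) < 2 ^ (k + 1) := by positivity
    calc 1 + (Nat.log 2 N + 1 : ℝ) * (2 ^ (k + 1) * T)
        ≤ T + (2 * Real.log N + 1) * (2 ^ (k + 1) * T) := by gcongr
      _ ≤ T * ((1 + 2 ^ (k + 1) * 2) * (1 + Real.log N)) := by
          have : 0 ≤ T * Real.log N := by positivity
          have : 0 ≤ T * 2 ^ (k + 1) := by positivity
          nlinarith
      _ ≤ T * X := by gcongr)
  set m := levelExp N i with hm
  set f := levelFun a N m k with hf
  set μ := ∫ α in (0 : ℝ)..1, f α with hμ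
  have hμ1 : μ ≤ 1 := by
    have := intervalIntegral.integral_mono_on zero_le_one
      ((continuous_levelFun a N m k).intervalIntegrable (μ := MeasureTheory.volume) 0 1)
      (continuous_const.intervalIntegrable 0 1) fun α _ => levelFun_le_one a m k α
    simpa using this
  have h2i0 : (0 : ℝ) < 2 ^ i := by positivity
  have hiN' : (2 : ℝ) ^ i ≤ N := by exact_mod_cast hiN
  have hNμ : 1 ≤ N * μ := by
    have hμ0 : 0 ≤ μ := by
      by_contra! hneg
      nlinarith
    calc 1 ≤ 2 ^ i * μ := hT1.trans hi
      _ ≤ N * μ := by gcongr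
  have hμ0 : 0 < μ := by
    by_contra! hneg
    nlinarith
  -- `H` is just large enough for the expected number `π(H) μ` of hits to be a power of `N`
  set H := ⌈X ^ 2 / μ⌉₊ with hH
  have hHge : X ^ 2 / μ ≤ H := Nat.le_ceil _
  have hX2μ : 1 ≤ X ^ 2 / μ := by rw [le_div_iff₀ hμ0]; nlinarith
  have hHle : (H : ℝ) ≤ 2 * (X ^ 2 / μ) := by
    have : (H : ℝ) < X ^ 2 / μ + 1 := Nat.ceil_lt_add_one (by positivity)
    linarith
  have hHX : X ≤ H := by
    refine le_trans ?_ hHge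
    rw [le_div_iff₀ hμ0]
    nlinarith
  have hX2 : X ^ 2 ≤ N := by
    rw [hX, ← Real.rpow_natCast, ← Real.rpow_mul hx0.le]
    calc (N : ℝ) ^ (δ * (2 : ℕ)) ≤ (N : ℝ) ^ (1 : ℝ) :=
          Real.rpow_le_rpow_of_exponent_le hx1 (by push_cast; linarith)
      _ = N := Real.rpow_one _
  have hHN : (H : ℝ) ≤ N ^ 3 := by
    have h1 : X ^ 2 / μ ≤ N ^ 2 := by
      rw [div_le_iff₀ hμ0]
      calc X ^ 2 ≤ N * 1 := by rw [mul_one]; exact hX2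
        _ ≤ N * (N * μ) := by gcongr
        _ = _ := by ring
    calc (H : ℝ) ≤ 2 * (X ^ 2 / μ) := hHle
      _ ≤ N * N ^ 2 := by gcongr
      _ = N ^ 3 := by ring
  have hlogX : (H₀ + 8 * Real.pi + 1 : ℝ) ≤ X := by
    refine le_trans ?_ hlog2
    have := Real.pi_pos
    have : (0 : ℝ) ≤ H₀ + 8 * Real.pi + 1 := by positivity
    nlinarith
  have hpi := Real.pi_pos
  have hH0 : (0 : ℝ) < H := by linarith
  have hcard : (H : ℝ) ≤ 6 * (Nat.primesLE H).card * Real.log N := by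
    have h1 : H₀ ≤ H := by
      have : (H₀ : ℝ) ≤ H := by linarith
      exact_mod_cast this
    have h2 : Real.log H ≤ 3 * Real.log N := by
      have := Real.log_le_log hH0 hHN
      rw [Real.log_pow] at this
      exact_mod_cast this
    calc (H : ℝ) ≤ 2 * (Nat.primesLE H).card * Real.log H := hH₀ H h1
      _ ≤ 2 * (Nat.primesLE H).card * (3 * Real.log N) := by gcongr
      _ = _ := by ring
  have hP0 : (0 : ℝ) < (Nat.primesLE H).card := by
    by_contra! hneg
    have : ((Nat.primesLE H).card : ℝ) * Real.log N ≤ 0 :=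
      mul_nonpos_of_nonpos_of_nonneg hneg hl0.le
    linarith
  have hmk : (m : ℝ) * 4 ^ i ≤ 2 * (N : ℝ) ^ 2 := levelExp_le hiN
  -- the degree of the level function is polynomial in `N`
  set A := N ^ t with hA
  have hf_mem : (fun α => (f α : ℂ)) ∈ trigPoly ((A + A) * m * k) :=
    levelFun_mem_trigPoly (fun n hn => by rw [hA]; push_cast; exact ha n hn) m k
  have hdeg : (1 + Nat.log 2 ((A + A) * m * k) : ℝ) ≤ 2 * (t + 4) * (1 + Real.log N) := by
    refine log_degree_le hN0 hN4 ?_ t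
    have h1 : (m : ℝ) ≤ 2 * (N : ℝ) ^ 2 :=
      (le_mul_of_one_le_right (by positivity) (one_le_pow₀ (by norm_num))).trans hmk
    exact_mod_cast h1
  have hbad := volume_forall_prime_dilate_lt_le hf_mem (levelFun_nonneg a m k)
    (levelFun_le_one a m k) hμ0 (Nat.primesLE H) (fun p hp => Nat.prime_of_mem_primesLE hp)
    (Finset.card_pos.mp (by exact_mod_cast hP0))
  refine (MeasureTheory.measure_mono ?_).trans (hbad.trans (ENNReal.ofReal_le_ofReal ?_))
  · intro α hα p hp
    by_contra! hge
    rw [Set.mem_ofPred_eq] at hα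
    have hpH : (p : ℝ) ≤ H := by exact_mod_cast (Nat.mem_primesLE.mp hp).1
    have hXk : (N : ℝ) ≤ X ^ k := by
      rw [hX, ← Real.rpow_natCast, ← Real.rpow_mul hx0.le]
      calc (N : ℝ) = (N : ℝ) ^ (1 : ℝ) := (Real.rpow_one _).symm
        _ ≤ _ := Real.rpow_le_rpow_of_exponent_le hx1 (by linarith)
    have h1 := le_norm_expSum_of_le_levelFun hN3 hX1 hXk hiN hNμ hge
    have h2 := norm_expSum_nat_mul_le a hN0 α (Nat.prime_of_mem_primesLE hp).pos
    set R : ℝ := (N : ℝ) ^ (τ - 6 * δ) with hR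
    have hR0 : 0 < R := Real.rpow_pos_of_pos hx0 _
    have hRT : R * X ^ 4 = T := by
      rw [hR, hX, hT, ← Real.rpow_natCast, ← Real.rpow_mul hx0.le, ← Real.rpow_add hx0]
      congr 1; push_cast; ring
    have h3 : 2 ^ i / (2 * X) ≤ 2 * Real.pi * (2 * (X ^ 2 / μ)) * R := by
      refine (h1.trans h2).trans ?_
      calc 2 * Real.pi * p * (N * discrepancy (fun n => Int.fract ((a n : ℝ) * α)) N)
          ≤ 2 * Real.pi * p * R := by gcongr
        _ ≤ _ := by gcongr; exact hpH.trans hHle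
    rw [div_le_iff₀ (by positivity)] at h3
    have h4 : T ≤ 8 * Real.pi * X ^ 3 * R := by
      calc T ≤ 2 ^ i * μ := hi
        _ ≤ 2 * Real.pi * (2 * (X ^ 2 / μ)) * R * (2 * X) * μ := by gcongr
        _ = _ := by field_simp; ring
    have h5 : 8 * Real.pi * X ^ 3 * R < X * X ^ 3 * R := by
      gcongr
      linarith [Nat.cast_nonneg (α := ℝ) H₀]
    have h6 : X * X ^ 3 * R = T := by rw [← hRT]; ring
    linarith
  · change 4 * ((1 + Nat.log 2 ((A + A) * m * k) : ℕ) : ℝ) / ((Nat.primesLE H).card * μ) ≤ _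
    rw [div_le_iff₀ (by positivity), Real.rpow_neg hx0.le, ← hX]
    push_cast
    have h1 : X ^ 2 ≤ 6 * Real.log N * ((Nat.primesLE H).card * μ) := by
      rw [div_le_iff₀ hμ0] at hHge
      calc X ^ 2 ≤ H * μ := hHge
        _ ≤ 6 * (Nat.primesLE H).card * Real.log N * μ := by gcongr
        _ = _ := by ring
    set P : ℝ := (Nat.primesLE H).card * μ with hP
    have hPp : 0 < P := by positivity
    have hhalf : (N : ℝ) ^ (δ / 2) * (N : ℝ) ^ (δ / 2) = X := by
      rw [hX, ← Real.rpow_add hx0]; ring_nf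
    have h2 : (24 * (2 * (t + 4)) * (1 + Real.log N)) * (1 * (1 + Real.log N)) ≤ X := by
      rw [← hhalf]
      gcongr
    have h3 : 4 * (1 + Nat.log 2 ((A + A) * m * k) : ℝ) * (6 * Real.log N) ≤ X := by
      refine le_trans ?_ h2
      calc 4 * (1 + Nat.log 2 ((A + A) * m * k) : ℝ) * (6 * Real.log N)
          ≤ 4 * (2 * (t + 4) * (1 + Real.log N)) * (6 * (1 + Real.log N)) := by
            gcongr; linarith
        _ = _ := by ring
    rw [inv_mul_eq_div, le_div_iff₀ hX0]
    set Q : ℝ := 4 * (1 + Nat.log 2 ((A + A) * m * k) : ℝ) with hQ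
    have hQ0 : 0 < Q := by positivity
    refine le_of_mul_le_mul_right ?_ hX0
    calc Q * X * X = Q * X ^ 2 := by ring
      _ ≤ Q * (6 * Real.log N * P) := by gcongr
      _ = (Q * (6 * Real.log N)) * P := by ring
      _ ≤ X * P := by gcongr
      _ = P * X := by ring

/-! ### Almost every `α` -/

/-- The exponent `t + 1` absorbs the finitely many terms not subject to the growth condition. -/
theorem eventually_abs_le_pow {a : ℕ → ℤ} {t : ℕ}
    (ha : ∃ n₀ : ℕ, ∀ n : ℕ, n₀ ≤ n → |a n| ≤ (n : ℤ) ^ t) :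
    ∀ᶠ N : ℕ in atTop, ∀ n ∈ Finset.Icc 1 N, |a n| ≤ (N : ℤ) ^ (t + 1) := by
  obtain ⟨n₀, hn₀⟩ := ha
  filter_upwards [eventually_ge_atTop (∑ n ∈ Finset.range n₀, (a n).natAbs),
    eventually_ge_atTop 1] with N hN hN1 n hn
  have hN1' : (1 : ℤ) ≤ N := by exact_mod_cast hN1
  rcases lt_or_ge n n₀ with h | h
  · have h1 := Finset.single_le_sum (f := fun n => (a n).natAbs) (fun _ _ => Nat.zero_le _)
      (Finset.mem_range.mpr h)
    have h2 : |a n| ≤ N := by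
      rw [Int.abs_eq_natAbs]; exact_mod_cast h1.trans hN
    exact h2.trans (le_self_pow₀ hN1' (by omega))
  · refine (hn₀ n h).trans ?_
    have h3 : (n : ℤ) ≤ N := by exact_mod_cast (Finset.mem_Icc.mp hn).2
    calc (n : ℤ) ^ t ≤ (N : ℤ) ^ t := by gcongr
      _ ≤ _ := pow_le_pow_right₀ hN1' (by omega)

theorem theorem3 (a : ℕ → ℤ) (t : ℕ)
    (ha : ∃ n₀ : ℕ, ∀ n : ℕ, n₀ ≤ n → |a n| ≤ (n : ℤ) ^ t)
    (τ : ℝ) (hτ0 : 0 < τ) (hτ1 : τ < 1)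
    (B : ℕ → ℕ) (hBpos : ∀ L : ℕ, 1 ≤ L → 0 < B L)
    (hBmono : StrictMonoOn B (Set.Ici 1))
    (b' b : ℝ) (hb' : 1 < b') (hb : b' < b)
    (hBbd : ∀ L : ℕ, 1 ≤ L → b' ^ L ≤ (B L : ℝ) ∧ (B L : ℝ) ≤ b ^ L)
    (hL1 : ∀ ε : ℝ, 0 < ε → ∃ L₀ : ℕ, ∀ L : ℕ, L₀ < L →
      (B L : ℝ) ^ (τ - ε) <
        ∫ α in (0 : ℝ)..1, ‖∑ n ∈ Finset.Icc 1 (B L),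
          Complex.exp (2 * (Real.pi : ℂ) * Complex.I * (a n : ℂ) * (α : ℂ))‖) :
    ∀ᵐ α : ℝ ∂(MeasureTheory.volume.restrict (Set.Ico (0 : ℝ) 1)),
      ∀ ε : ℝ, 0 < ε →
        {N : ℕ | (N : ℝ) ^ (τ - ε) <
          (N : ℝ) * discrepancy (fun n => Int.fract ((a n : ℝ) * α)) N}.Infinite := by
  have hBtop : Tendsto B atTop atTop := by
    rw [← tendsto_natCast_atTop_iff (R := ℝ)]
    refine tendsto_atTop_mono' atTop ?_ (tendsto_pow_atTop_atTop_of_one_lt hb')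
    filter_upwards [eventually_ge_atTop 1] with L hL using (hBbd L hL).1
  have hmain : ∀ δ : ℝ, 0 < δ → δ ≤ 1 / 2 → 2 * δ ≤ τ →
      ∀ᵐ α : ℝ ∂(MeasureTheory.volume.restrict (Set.Ico (0 : ℝ) 1)), ∀ᶠ L : ℕ in atTop,
        (B L : ℝ) ^ (τ - 6 * δ) <
          (B L : ℝ) * discrepancy (fun n => Int.fract ((a n : ℝ) * α)) (B L) := by
    intro δ hδ0 hδ hδτ
    obtain ⟨L₀, hL₀⟩ := hL1 δ hδ0
    have hev := (hBtop.eventually (eventually_volume_discrepancy_le (t + 1) hδ0 hδ hδτ)).and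
      ((hBtop.eventually (eventually_abs_le_pow ha)).and
        ((eventually_gt_atTop L₀).and (eventually_ge_atTop 1)))
    obtain ⟨L₁, hL₁⟩ := eventually_atTop.mp hev
    set r : ℝ := b' ^ (-δ) with hr
    have hr0 : 0 < r := Real.rpow_pos_of_pos (by linarith) _
    have hr1 : r < 1 := Real.rpow_lt_one_of_one_lt_of_neg hb' (by linarith)
    set E : ℕ → Set ℝ := fun L =>
      {α | (B (L + L₁) : ℝ) * discrepancy (fun n => Int.fract ((a n : ℝ) * α)) (B (L + L₁)) ≤
        (B (L + L₁) : ℝ) ^ (τ - 6 * δ)} with hE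
    have hEle : ∀ L, MeasureTheory.volume.restrict (Set.Ico (0 : ℝ) 1) (E L) ≤
        ENNReal.ofReal (r ^ (L + L₁)) := by
      intro L
      obtain ⟨h1, h2, h3, h4⟩ := hL₁ (L + L₁) (by omega)
      refine (h1 a h2 (hL₀ _ h3)).trans (ENNReal.ofReal_le_ofReal ?_)
      calc (B (L + L₁) : ℝ) ^ (-δ) ≤ (b' ^ (L + L₁)) ^ (-δ) :=
            Real.rpow_le_rpow_of_nonpos (by positivity) (hBbd _ h4).1 (by linarith)
        _ = r ^ (L + L₁) := by
            rw [hr, ← Real.rpow_natCast, ← Real.rpow_natCast, ← Real.rpow_mul (by linarith),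
              ← Real.rpow_mul (by linarith), mul_comm]
    have hsum : Summable fun L : ℕ => r ^ (L + L₁) :=
      (summable_nat_add_iff L₁).mpr (summable_geometric_of_lt_one hr0.le hr1)
    have hfin : ∑' L, MeasureTheory.volume.restrict (Set.Ico (0 : ℝ) 1) (E L) ≠ ⊤ :=
      ne_top_of_le_ne_top hsum.tsum_ofReal_ne_top (ENNReal.tsum_le_tsum hEle)
    filter_upwards [MeasureTheory.ae_eventually_notMem hfin] with α hα
    rw [← map_add_atTop_eq_nat L₁, eventually_map]
    filter_upwards [hα] with L hL
    exact not_le.mp hL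
  -- countably many values of `δ` suffice
  set δ : ℕ → ℝ := fun q => τ / 2 / (q + 1) with hδdef
  have hδ0 : ∀ q, 0 < δ q := fun q => by positivity
  have hδle : ∀ q, δ q ≤ τ / 2 := fun q =>
    div_le_self (by positivity) (by linarith [Nat.cast_nonneg (α := ℝ) q])
  have hall := MeasureTheory.ae_all_iff.mpr fun q =>
    hmain (δ q) (hδ0 q) ((hδle q).trans (by linarith)) (by linarith [hδle q])
  filter_upwards [hall] with α hα ε hε
  obtain ⟨q, hq⟩ := exists_nat_gt (6 * (τ / 2) / ε)
  have hqε : 6 * δ q ≤ ε := by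
    have h1 : (0 : ℝ) < q + 1 := by positivity
    rw [div_lt_iff₀ hε] at hq
    rw [hδdef, ← mul_div_assoc, div_le_iff₀ h1]
    nlinarith
  refine Set.infinite_of_forall_exists_gt fun M => ?_
  obtain ⟨L, hL, hLM, hL1⟩ := ((hα q).and ((hBtop.eventually_gt_atTop M).and
    (eventually_ge_atTop 1))).exists
  refine ⟨B L, lt_of_le_of_lt ?_ hL, hLM⟩
  exact Real.rpow_le_rpow_of_exponent_le (by exact_mod_cast hBpos L hL1) (by linarith)
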